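/- Let $q$ be a fixed prime power and let $\mathbb{F}_q$ be the field with $q$ elements. For each $n$, let $v_1,v_2,\dots$ be independent uniformly random vectors in $\mathbb{F}_q^n$, let $A_m=[v_1,\dots,v_m]$ be the $n\times m$ matrix with columns $v_1,\dots,v_m$, and let $M[A_m]$ be the matroid on the column indices $\{1,\dots,m\}$ in which a set of indices is independent if and only if the corresponding family of columns is linearly independent. A circuit is a minimal dependent set, and its length is its number of elements. Then, with all limits taken as $n\to\infty$: (a) The first circuit appearing in the process has length asymptotic to $(1-1/q)n$, asymptotically almost surely. That is, for every $\varepsilon>0$, with probability tending to $1$, at the smallest step $m$ at which $M[A_m]$ has a circuit, it has exactly one circuit $C$, and $$\bigl|\,|C|-(1-1/q)n\,\bigr|\le \varepsilon\,(1-1/q)n .$$ (b) The first Hamilton circuit (that is, circuit of length $n$) appears in fewer than $2n$ steps, asymptotically almost surely: if $\tau$ is the minimum $m$ such that $M[A_m]$ has a circuit of length $n$ (with $\tau=\infty$ if there is none), then $\Pr(\tau<2n)\to 1$. This holds for every prime power $q$. -/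

import Mathlib

open MeasureTheory ProbabilityTheory Filter Topology

/-- The augmentation property of linear independence among the members of a finite family. -/
theorem linearIndepOn_augment {F V α : Type*} [Field F] [AddCommGroup V] [Module F V] [Finite α]
    (c : α → V) {I J : Set α} (hI : LinearIndepOn F c I) (hJ : LinearIndepOn F c J)
    (hlt : I.ncard < J.ncard) : ∃ e ∈ J, e ∉ I ∧ LinearIndepOn F c (insert e I) := by
  classical
  by_contra! hcon
  have hspan : Submodule.span F (c '' J) ≤ Submodule.span F (c '' I) := by
    rw [Submodule.span_le]
    rintro _ ⟨e, he, rfl⟩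
    by_cases heI : e ∈ I
    · exact Submodule.subset_span ⟨e, heI, rfl⟩
    · by_contra hne
      exact hcon e he heI ((linearIndepOn_insert heI).2 ⟨hI, hne⟩)
  have : Fintype α := Fintype.ofFinite α
  have hdim : ∀ S : Set α, LinearIndepOn F c S →
      Module.finrank F (Submodule.span F (c '' S)) = S.ncard := by
    intro S hS
    have h := finrank_span_eq_card hS
    rw [← Set.image_eq_range] at h
    rw [h, ← Nat.card_coe_set_eq, Nat.card_eq_fintype_card]
  have : FiniteDimensional F (Submodule.span F (c '' I)) :=
    FiniteDimensional.span_of_finite F (Set.toFinite _)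
  have hle := Submodule.finrank_mono hspan
  rw [hdim I hI, hdim J hJ] at hle
  omega

/-- The matroid `M[A]` represented by a matrix `A`: its elements are the column indices of `A`,
and a set of indices is independent when the family of the corresponding columns is linearly
independent. -/
def Matrix.columnMatroid {F ι α : Type*} [Field F] [Finite α] (A : Matrix ι α F) : Matroid α :=
  (IndepMatroid.ofFinite (E := Set.univ) Set.finite_univ (fun I => LinearIndepOn F A.col I)
    (linearIndepOn_empty F A.col) (fun _ _ hJ hIJ => hJ.mono hIJ)
    (fun _ _ hI hJ hlt => linearIndepOn_augment A.col hI hJ hlt)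
    (fun I _ => Set.subset_univ I)).matroid

/-- The `n × m` matrix `A_m` whose columns are the first `m` vectors of the sequence `w`. -/
def firstColumns {F : Type*} {n : ℕ} (w : ℕ → Fin n → F) (m : ℕ) : Matrix (Fin n) (Fin m) F :=
  Matrix.of fun r j => w j r

/-- `C` is the first circuit of the matroid process `M[A_0], M[A_1], M[A_2], …` of the sequence
`w`, and it appears at step `m`: it is the one and only circuit of `M[A_m]`, and there is no
circuit at any earlier step. -/
def IsFirstCircuit {F : Type*} [Field F] {n : ℕ} (w : ℕ → Fin n → F) (m : ℕ)
    (C : Set (Fin m)) : Prop :=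
  (∀ D : Set (Fin m), (firstColumns w m).columnMatroid.IsCircuit D ↔ D = C) ∧
    ∀ m' < m, ∀ D : Set (Fin m'), ¬ (firstColumns w m').columnMatroid.IsCircuit D

/-- The minimum `m` such that `M[A_m]` has a circuit of length `k` (infinite if there is none). -/
noncomputable def circuitTime {F : Type*} [Field F] {n : ℕ} (w : ℕ → Fin n → F) (k : ℕ) : ℕ∞ :=
  ⨅ (m : ℕ) (_ : ∃ C : Set (Fin m), (firstColumns w m).columnMatroid.IsCircuit C ∧ C.ncard = k),
    (m : ℕ∞)

/-!
The first circuit is the support of the first linear relation that expresses some `v_{j+1}` by the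
independent vectors `v_1, …, v_j`, together with `j + 1`. A fixed relation holds with probability
`q⁻ⁿ`. Among the `q ^ j` coefficient vectors, Chebyshev's inequality for the Hamming weight bounds
the number of those whose support has a size far from `(1 - 1/q) n`, and the union bound over all
relations decays geometrically in `n - j`, so that only `j` close to `n` matters.

Hamilton circuits among the first `2n - 1` vectors are found by the second moment method. The
automorphism group of `V = F ^ n` acts transitively on independent families of a given size, so the
events that `S` and that `T` is a circuit are independent given that `S ∩ T` is independent, which
has probability at least `1 - 2 ^ (-|S \ T|)`. The resulting correlations are negligible because
`2 ^ (-|S \ T|)` averages to `(3 / 4) ^ n` over all sets `T`, and circuits are numerous because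
each of the roughly `4 ^ n` sets of size `n` is one with probability at least `q⁻¹ 2⁻ⁿ`.
-/

theorem tendsto_measure_one_of_hasLaw {Ω X : ℕ → Type*} [∀ n, MeasurableSpace (Ω n)]
    [∀ n, MeasurableSpace (X n)] {P : ∀ n, Measure (Ω n)} {μ : ∀ n, Measure (X n)}
    [∀ n, IsProbabilityMeasure (μ n)] {Y : ∀ n, Ω n → X n} (hY : ∀ n, HasLaw (Y n) (μ n) (P n))
    {B : ∀ n, Set (X n)} (hBmeas : ∀ n, MeasurableSet (B n)) {r : ℕ → ℝ}
    (hB : ∀ᶠ n in atTop, (μ n).real (B n) ≤ r n) (hr : Tendsto r atTop (𝓝 0))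
    {G : ∀ n, Set (Ω n)} (hG : ∀ᶠ n in atTop, ∀ ω, Y n ω ∉ B n → ω ∈ G n) :
    Tendsto (fun n => P n (G n)) atTop (𝓝 1) := by
  have : ∀ n, IsProbabilityMeasure (P n) := fun n => (hY n).isProbabilityMeasure
  have hlim : Tendsto (fun n => 1 - ENNReal.ofReal (r n)) atTop (𝓝 1) := by
    simpa using ENNReal.Tendsto.sub (tendsto_const_nhds (x := (1 : ENNReal)))
      (ENNReal.tendsto_ofReal hr) (Or.inl ENNReal.one_ne_top)
  refine tendsto_of_tendsto_of_tendsto_of_le_of_le' hlim tendsto_const_nhds ?_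
    (Eventually.of_forall fun n => prob_le_one)
  filter_upwards [hB, hG] with n hn hGn
  calc 1 - ENNReal.ofReal (r n)
      ≤ 1 - μ n (B n) := by
        rw [← ofReal_measureReal]
        gcongr
    _ = P n {ω | Y n ω ∈ (B n)ᶜ} := by
        rw [← prob_compl_eq_one_sub (hBmeas n)]
        exact ((hY n).measure_eq (p := (· ∈ (B n)ᶜ)) (hBmeas n).compl).symm
    _ ≤ P n (G n) := measure_mono hGn

theorem measureReal_forall_notMem_le {Ω ι : Type*} [MeasurableSpace Ω] {μ : Measure Ω}
    [IsProbabilityMeasure μ] {s : Finset ι} {E : ι → Set Ω} (hE : ∀ i ∈ s, MeasurableSet (E i))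
    (hpos : 0 < ∑ i ∈ s, μ.real (E i)) :
    μ.real {ω | ∀ i ∈ s, ω ∉ E i} ≤
      (∑ i ∈ s, ∑ j ∈ s, (μ.real (E i ∩ E j) - μ.real (E i) * μ.real (E j))) /
        (∑ i ∈ s, μ.real (E i)) ^ 2 := by
  let Z : Ω → ℝ := fun ω => ∑ i ∈ s, (E i).indicator 1 ω
  have hind : ∀ i ∈ s, MemLp ((E i).indicator (1 : Ω → ℝ)) 2 μ := fun i hi =>
    (memLp_const (1 : ℝ)).indicator (hE i hi)
  have hmean : μ[Z] = ∑ i ∈ s, μ.real (E i) := by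
    rw [integral_finsetSum s fun i hi => (hind i hi).integrable one_le_two]
    exact Finset.sum_congr rfl fun i hi => integral_indicator_one (hE i hi)
  have hcov : ∀ i ∈ s, ∀ j ∈ s, cov[(E i).indicator (1 : Ω → ℝ), (E j).indicator 1; μ] =
      μ.real (E i ∩ E j) - μ.real (E i) * μ.real (E j) := fun i hi j hj => by
    rw [covariance_eq_sub (hind i hi) (hind j hj), ← Set.inter_indicator_one,
      integral_indicator_one (hE i hi), integral_indicator_one (hE j hj),
      integral_indicator_one ((hE i hi).inter (hE j hj))]
  have hvar : Var[Z; μ] =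
      ∑ i ∈ s, ∑ j ∈ s, (μ.real (E i ∩ E j) - μ.real (E i) * μ.real (E j)) := by
    rw [variance_fun_sum' hind]
    exact Finset.sum_congr rfl fun i hi => Finset.sum_congr rfl fun j hj => hcov i hi j hj
  have hsub : {ω | ∀ i ∈ s, ω ∉ E i} ⊆ {ω | μ[Z] ≤ |Z ω - μ[Z]|} := fun ω hω => by
    have hZ : Z ω = 0 := Finset.sum_eq_zero fun i hi => Set.indicator_of_notMem (hω i hi) 1
    simp only [Set.mem_ofPred_eq, hZ, zero_sub, abs_neg]
    exact le_abs_self _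
  rw [← hvar, ← hmean]
  refine ENNReal.toReal_le_of_le_ofReal (div_nonneg (variance_nonneg _ _) (sq_nonneg _)) ?_
  exact (measure_mono hsub).trans
    (meas_ge_le_variance_div_sq (memLp_finsetSum s hind) (hmean ▸ hpos))

theorem measureReal_forall_notMem_le_of_inter_le {Ω ι : Type*} [MeasurableSpace Ω]
    {μ : Measure Ω} [IsProbabilityMeasure μ] {s : Finset ι} {E : ι → Set Ω} {p K : ℝ}
    {b : ι → ι → ℝ} (hE : ∀ i ∈ s, MeasurableSet (E i)) (hs : s.Nonempty) (hp : 0 < p)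
    (hEp : ∀ i ∈ s, μ.real (E i) = p) (hb : ∀ i j, 0 ≤ b i j)
    (hinter : ∀ i ∈ s, ∀ j ∈ s, i ≠ j → μ.real (E i ∩ E j) ≤ p ^ 2 * (1 + b i j))
    (hK : ∀ i ∈ s, ∑ j ∈ s, b i j ≤ K) :
    μ.real {ω | ∀ i ∈ s, ω ∉ E i} ≤ (p⁻¹ + K) / s.card := by
  classical
  have hs0 : (0 : ℝ) < s.card := Nat.cast_pos.2 hs.card_pos
  have hmean : ∑ i ∈ s, μ.real (E i) = s.card * p := by
    rw [Finset.sum_congr rfl hEp, Finset.sum_const, nsmul_eq_mul]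
  have hcov : ∀ i ∈ s, ∀ j ∈ s, μ.real (E i ∩ E j) - μ.real (E i) * μ.real (E j) ≤
      (if i = j then p else 0) + p ^ 2 * b i j := fun i hi j hj => by
    rw [hEp i hi, hEp j hj]
    split_ifs with hij
    · rw [← hij, Set.inter_self, hEp i hi]
      nlinarith [mul_nonneg (sq_nonneg p) (hb i i)]
    · linarith [hinter i hi j hj hij]
  have hrow : ∀ i ∈ s, ∑ j ∈ s, (μ.real (E i ∩ E j) - μ.real (E i) * μ.real (E j)) ≤
      p + p ^ 2 * K := fun i hi => by
    refine (Finset.sum_le_sum (hcov i hi)).trans ?_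
    rw [Finset.sum_add_distrib, Finset.sum_ite_eq, if_pos hi, ← Finset.mul_sum]
    gcongr
    exact hK i hi
  calc μ.real {ω | ∀ i ∈ s, ω ∉ E i}
      ≤ (∑ i ∈ s, ∑ j ∈ s, (μ.real (E i ∩ E j) - μ.real (E i) * μ.real (E j))) /
          (s.card * p) ^ 2 :=
        hmean ▸ measureReal_forall_notMem_le hE (hmean ▸ mul_pos hs0 hp)
    _ ≤ s.card * (p + p ^ 2 * K) / (s.card * p) ^ 2 := by
        gcongr
        rw [← nsmul_eq_mul]
        exact Finset.sum_le_card_nsmul _ _ _ hrow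
    _ = (p⁻¹ + K) / s.card := by
        field_simp

/-- The law of a family, indexed by `α`, of independent uniformly random members of `V`. -/
noncomputable abbrev uniformFamily (α V : Type*) [MeasurableSpace V] : Measure (α → V) :=
  uniformOn Set.univ

section UniformFamily

variable {α V : Type*} [Finite α] [MeasurableSpace V] [MeasurableSingletonClass V]

theorem hasLaw_uniformFamily [Finite V] {Ω : Type*} [MeasurableSpace Ω] {P : Measure Ω}
    {v : α → Ω → V} (hlaw : ∀ i, HasLaw (v i) (uniformOn Set.univ) P) (hindep : iIndepFun v P) :
    HasLaw (fun ω i => v i ω) (uniformFamily α V) P := by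
  have := Fintype.ofFinite α
  simpa only [← uniformOn_pi, Set.pi_univ] using hindep.hasLaw_pi hlaw

theorem uniformFamily_real_apply [Finite V] (E : Set (α → V)) :
    (uniformFamily α V).real E = E.ncard / Nat.card (α → V) := by
  have := Fintype.ofFinite (α → V)
  rw [measureReal_def, uniformOn_univ, Measure.count_apply_finite E E.toFinite, ENNReal.toReal_div,
    Nat.card_eq_fintype_card, Set.ncard_eq_toFinset_card E]
  simp

theorem uniformFamily_real_inter_apply_eq [Fintype V] [Nonempty V] {j : α} {E : Set (α → V)}
    {f : (α → V) → V} (hE : DependsOn (· ∈ E) {j}ᶜ) (hf : DependsOn f {j}ᶜ) :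
    (uniformFamily α V).real (E ∩ {A | A j = f A}) =
      (uniformFamily α V).real E / Fintype.card V := by
  classical
  have hupdate : ∀ (A : α → V) v, ∀ i ∈ ({j}ᶜ : Set α), Function.update A j v i = A i :=
    fun A v i hi => Function.update_of_ne hi v A
  have hE' : ∀ A v, Function.update A j v ∈ E ↔ A ∈ E := fun A v => iff_of_eq (hE (hupdate A v))
  have hf' : ∀ A v, f (Function.update A j v) = f A := fun A v => hf (hupdate A v)
  have hbij : Set.BijOn (fun p : (α → V) × V => Function.update p.1 j p.2)
      ((E ∩ {A | A j = f A}) ×ˢ Set.univ) E := by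
    refine Set.InvOn.bijOn (f' := fun A => (Function.update A j (f A), A j))
      ⟨fun p hp => ?_, fun A _ => by simp⟩ (fun p hp => (hE' _ _).2 hp.1.1)
      fun A hA => ⟨⟨(hE' _ _).2 hA, by simp [hf']⟩, trivial⟩
    have hpj : f p.1 = p.1 j := hp.1.2.symm
    simp [hf', hpj]
  have hcard := hbij.ncard_eq
  rw [Set.ncard_prod, Set.ncard_univ, Nat.card_eq_fintype_card] at hcard
  have hV : (Fintype.card V : ℝ) ≠ 0 := Nat.cast_ne_zero.2 Fintype.card_ne_zero
  rw [uniformFamily_real_apply, uniformFamily_real_apply, ← hcard, eq_div_iff hV]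
  push_cast
  ring

theorem uniformFamily_real_preimage_comp_perm [Finite V] (σ : Equiv.Perm α) (E : Set (α → V)) :
    (uniformFamily α V).real {A | A ∘ σ ∈ E} = (uniformFamily α V).real E := by
  rw [uniformFamily_real_apply, uniformFamily_real_apply]
  congr 2
  exact Set.ncard_preimage_of_injective_subset_range
    (σ.surjective.injective_comp_right) fun A _ => ⟨A ∘ σ.symm, by ext; simp⟩

end UniformFamily

section LinearFamily

variable {F α V : Type*} [Field F] [Finite α] [AddCommGroup V] [Module F V] [Fintype V]
  [MeasurableSpace V] [MeasurableSingletonClass V]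

theorem uniformFamily_real_sum_smul_eq_zero {U : Finset α} {x : U → F} (hx : x ≠ 0) :
    (uniformFamily α V).real {A | ∑ i, x i • A i = 0} = 1 / Fintype.card V := by
  classical
  obtain ⟨j, hj⟩ : ∃ j, x j ≠ 0 := Function.ne_iff.1 hx
  have hsolve : {A : α → V | ∑ i, x i • A i = 0} =
      Set.univ ∩ {A | A j = -(x j)⁻¹ • ∑ i ∈ Finset.univ.erase j, x i • A i} := by
    ext A
    rw [Set.univ_inter, Set.mem_ofPred_eq, Set.mem_ofPred_eq,
      ← Finset.add_sum_erase _ _ (Finset.mem_univ j), add_eq_zero_iff_eq_neg, neg_smul, ← smul_neg,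
      eq_inv_smul_iff₀ hj]
  rw [hsolve, uniformFamily_real_inter_apply_eq (fun _ _ _ => rfl), probReal_univ]
  refine fun A B hAB => congrArg (-(x j)⁻¹ • ·) (Finset.sum_congr rfl fun i hi => ?_)
  rw [hAB i (Subtype.coe_ne_coe.2 (Finset.ne_of_mem_erase hi))]

theorem one_sub_le_uniformFamily_real_linearIndepOn [Fintype F] (U : Finset α) :
    1 - (Fintype.card F : ℝ) ^ U.card / Fintype.card V ≤
      (uniformFamily α V).real {A | LinearIndepOn F A U} := by
  classical
  have hsub : {A : α → V | LinearIndepOn F A U}ᶜ ⊆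
      ⋃ x ∈ Finset.univ.erase (0 : U → F), {A | ∑ i, x i • A i = 0} := fun A hA => by
    obtain ⟨x, hx, i, hi⟩ := Fintype.not_linearIndependent_iff.1 hA
    simp only [Set.mem_iUnion]
    exact ⟨x, Finset.mem_erase.2 ⟨fun h => hi (congrFun h i), Finset.mem_univ x⟩, hx⟩
  have hcompl : (uniformFamily α V).real {A | LinearIndepOn F A U}ᶜ ≤
      (Fintype.card F : ℝ) ^ U.card / Fintype.card V :=
    calc (uniformFamily α V).real {A | LinearIndepOn F A U}ᶜ
        ≤ ∑ x ∈ Finset.univ.erase (0 : U → F),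
            (uniformFamily α V).real {A | ∑ i, x i • A i = 0} :=
          (measureReal_mono hsub (measure_ne_top _ _)).trans (measureReal_biUnion_finset_le _ _)
      _ = (Finset.univ.erase (0 : U → F)).card * (1 / Fintype.card V) := by
          rw [← nsmul_eq_mul]
          exact Finset.sum_eq_card_nsmul fun x hx =>
            uniformFamily_real_sum_smul_eq_zero (Finset.ne_of_mem_erase hx)
      _ ≤ (Fintype.card (U → F) : ℝ) * (1 / Fintype.card V) := by
          gcongr
          exact Finset.card_le_univ _
      _ = (Fintype.card F : ℝ) ^ U.card / Fintype.card V := by simp [div_eq_mul_inv]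
  rw [probReal_compl_eq_one_sub .of_discrete] at hcompl
  linarith

theorem one_sub_half_pow_le_uniformFamily_real_linearIndepOn [Fintype F] {n j : ℕ}
    (hV : Fintype.card V = Fintype.card F ^ n) {U : Finset α} (hU : U.card + j = n) :
    1 - (1 / 2 : ℝ) ^ j ≤ (uniformFamily α V).real {A | LinearIndepOn F A U} := by
  have hq : (2 : ℝ) ≤ Fintype.card F := by exact_mod_cast Fintype.one_lt_card (α := F)
  refine le_trans ?_ (one_sub_le_uniformFamily_real_linearIndepOn U)
  rw [hV, ← hU, Nat.cast_pow, pow_add, div_mul_cancel_left₀ (by positivity), one_div, inv_pow]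
  gcongr

end LinearFamily

/-- The members of the family `A` indexed by `S` form a circuit, that is, a minimal linearly
dependent subfamily: this extends the circuits of `Matrix.columnMatroid` to families of vectors in
an arbitrary vector space. -/
def IsCircuitOn (F : Type*) {α V : Type*} [Field F] [AddCommGroup V] [Module F V] (A : α → V)
    (S : Set α) : Prop :=
  ¬ LinearIndepOn F A S ∧ ∀ T ⊂ S, LinearIndepOn F A T

section Circuits

variable {F α V : Type*} [Field F] [AddCommGroup V] [Module F V] {A : α → V}

theorem isCircuitOn_comp_equiv {β : Type*} (e : β ≃ α) {S : Set β} :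
    IsCircuitOn F (A ∘ e) S ↔ IsCircuitOn F A (e '' S) := by
  simp only [IsCircuitOn, linearIndepOn_equiv, e.surjective.image_surjective.forall,
    Set.ssubset_def, Set.image_subset_image_iff e.injective]

theorem isCircuitOn_insert [DecidableEq α] {U : Finset α} {l : α}
    (hA : LinearIndepOn F A U) (hl : l ∉ U) {c : U → F} (hc : ∀ i, c i ≠ 0)
    (hAl : A l = ∑ i, c i • A i) : IsCircuitOn F A (insert l U : Finset α) := by
  rw [Finset.coe_insert]
  have hterm : ∀ i : U, ∀ W : Set α, ↑i ∈ W → c i • A i ∈ Submodule.span F (A '' W) :=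
    fun i W hi => Submodule.smul_mem _ _ (Submodule.subset_span (Set.mem_image_of_mem A hi))
  refine ⟨fun h => ?_, fun T hT => ?_⟩
  · refine ((linearIndepOn_insert hl).1 h).2 ?_
    rw [hAl]
    exact Submodule.sum_mem _ fun i _ => hterm i U i.2
  · obtain ⟨e, he, heT⟩ := Set.exists_of_ssubset hT
    obtain rfl | heU := he
    · exact hA.mono ((Set.subset_insert_iff_of_notMem heT).1 hT.subset)
    · have hrest : ∑ i ∈ Finset.univ.erase ⟨e, heU⟩, c i • A i ∈
          Submodule.span F (A '' (U \ {e})) :=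
        Submodule.sum_mem _ fun i hi =>
          hterm i _ ⟨i.2, fun h => Finset.ne_of_mem_erase hi (Subtype.ext h)⟩
      have hl' : A l ∉ Submodule.span F (A '' (U \ {e})) := by
        rw [hAl, ← Finset.add_sum_erase _ _ (Finset.mem_univ ⟨e, heU⟩),
          Submodule.add_mem_iff_left _ hrest, Submodule.smul_mem_iff _ (hc _)]
        exact linearIndepOn_iff_notMem_span.1 hA e heU
      refine ((linearIndepOn_insert fun h => hl h.1).2 ⟨hA.mono Set.sdiff_subset, hl'⟩).mono
        fun i hi => ?_
      obtain rfl | hiU := hT.subset hi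
      · exact Set.mem_insert _ _
      · exact Set.mem_insert_of_mem _ ⟨hiU, fun h => heT (h ▸ hi)⟩

end Circuits

section GeneralLinear

variable {F α V : Type*} [Field F] [AddCommGroup V] [Module F V]

/-- The event `E` about a family of vectors depends only on the members indexed by `S`, and only up
to a common linear automorphism applied to them. -/
def GLInvariantOn (F : Type*) {α V : Type*} [Field F] [AddCommGroup V] [Module F V] (S : Set α)
    (E : Set (α → V)) : Prop :=
  ∀ (g : V ≃ₗ[F] V) (A B : α → V), Set.EqOn (g ∘ A) B S → (A ∈ E ↔ B ∈ E)

theorem GLInvariantOn.dependsOn {S : Set α} {E : Set (α → V)} (hE : GLInvariantOn F S E) :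
    DependsOn (· ∈ E) S :=
  fun A B hAB => propext (hE (LinearEquiv.refl F V) A B hAB)

theorem glInvariantOn_linearIndepOn (S : Set α) :
    GLInvariantOn F S {A : α → V | LinearIndepOn F A S} := fun g A B hAB => by
  have hg : LinearIndepOn F (g ∘ A) S ↔ LinearIndepOn F A S :=
    LinearMap.linearIndependent_iff (v := fun i : S => A i) g.toLinearMap g.ker
  exact hg.symm.trans ⟨fun h => h.congr hAB, fun h => h.congr hAB.symm⟩

theorem glInvariantOn_isCircuitOn (S : Set α) :
    GLInvariantOn F S {A : α → V | IsCircuitOn F A S} := fun g A B hAB =>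
  and_congr (not_congr (glInvariantOn_linearIndepOn S g A B hAB)) <| forall₂_congr fun T hT =>
    glInvariantOn_linearIndepOn T g A B (hAB.mono hT.subset)

theorem exists_linearEquiv_apply_eq [FiniteDimensional F V] {ι : Type*} {a b : ι → V}
    (ha : LinearIndependent F a) (hb : LinearIndependent F b) :
    ∃ g : V ≃ₗ[F] V, ∀ i, g (b i) = a i := by
  obtain ⟨g, hg⟩ := Submodule.exists_linearEquiv_restrict_eq
    (hb.linearCombinationEquiv.symm ≪≫ₗ ha.linearCombinationEquiv)
  refine ⟨g, fun i => ?_⟩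
  have hbi : hb.linearCombinationEquiv (Finsupp.single i 1) =
      ⟨b i, Submodule.subset_span ⟨i, rfl⟩⟩ := by
    ext
    simp
  have hgi := hg ⟨b i, Submodule.subset_span ⟨i, rfl⟩⟩
  rw [LinearEquiv.trans_apply, ← hbi, LinearEquiv.symm_apply_apply, hbi] at hgi
  rw [← hgi]
  simp

open Classical in
/-- A linear automorphism that takes `b i` to `a i` for all `i`. It is the identity if there is no
such automorphism. -/
noncomputable def aligningEquiv (F : Type*) {V ι : Type*} [Field F] [AddCommGroup V] [Module F V]
    (a b : ι → V) : V ≃ₗ[F] V :=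
  if h : ∃ g : V ≃ₗ[F] V, ∀ i, g (b i) = a i then h.choose else LinearEquiv.refl F V

theorem aligningEquiv_apply [FiniteDimensional F V] {ι : Type*} {a b : ι → V}
    (ha : LinearIndependent F a) (hb : LinearIndependent F b) (i : ι) :
    aligningEquiv F a b (b i) = a i := by
  have h := exists_linearEquiv_apply_eq ha hb
  rw [aligningEquiv, dif_pos h]
  exact h.choose_spec i

open Classical in
/-- Exchange the members of two families outside `S`, after aligning the second family with the
first on `K`. If `K = S ∩ T` and both families are independent on `K`, this exchanges their
restrictions to `T` up to a linear automorphism. -/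
noncomputable def alignedSwap (F : Type*) {α V : Type*} [Field F] [AddCommGroup V] [Module F V]
    (S K : Set α) (p : (α → V) × (α → V)) : (α → V) × (α → V) :=
  let g : V ≃ₗ[F] V := aligningEquiv F (K.domRestrict p.1) (K.domRestrict p.2)
  (S.piecewise p.1 (g ∘ p.2), S.piecewise p.2 (g.symm ∘ p.1))

theorem alignedSwap_fst_eqOn (S K : Set α) (p : (α → V) × (α → V)) :
    Set.EqOn (alignedSwap F S K p).1 p.1 S := by
  classical exact Set.piecewise_eqOn _ _ _

theorem alignedSwap_snd_eqOn (S K : Set α) (p : (α → V) × (α → V)) :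
    Set.EqOn (alignedSwap F S K p).2 p.2 S := by
  classical exact Set.piecewise_eqOn _ _ _

theorem involutive_alignedSwap {S K : Set α} (hK : K ⊆ S) :
    Function.Involutive (alignedSwap (V := V) F S K) := fun p => by
  have hfst : K.domRestrict (alignedSwap F S K p).1 = K.domRestrict p.1 :=
    Set.domRestrict_eq_domRestrict_iff.2 ((alignedSwap_fst_eqOn S K p).mono hK)
  have hsnd : K.domRestrict (alignedSwap F S K p).2 = K.domRestrict p.2 :=
    Set.domRestrict_eq_domRestrict_iff.2 ((alignedSwap_snd_eqOn S K p).mono hK)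
  rw [alignedSwap, hfst, hsnd]
  ext i <;> by_cases hi : i ∈ S <;> simp [alignedSwap, hi]

theorem exists_eqOn_alignedSwap [FiniteDimensional F V] {S T : Set α} {p : (α → V) × (α → V)}
    (hfst : LinearIndepOn F p.1 (S ∩ T)) (hsnd : LinearIndepOn F p.2 (S ∩ T)) :
    ∃ g : V ≃ₗ[F] V, Set.EqOn (g ∘ p.2) (alignedSwap F S (S ∩ T) p).1 T ∧
      Set.EqOn (g.symm ∘ p.1) (alignedSwap F S (S ∩ T) p).2 T := by
  set g := aligningEquiv F ((S ∩ T).domRestrict p.1) ((S ∩ T).domRestrict p.2) with hg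
  have halign : ∀ i ∈ S ∩ T, g (p.2 i) = p.1 i := fun i hi => aligningEquiv_apply hfst hsnd ⟨i, hi⟩
  refine ⟨g, fun i hiT => ?_, fun i hiT => ?_⟩ <;> by_cases hiS : i ∈ S
  · simp [alignedSwap, hiS, halign i ⟨hiS, hiT⟩]
  · simp [alignedSwap, hiS, hg]
  · simp [alignedSwap, hiS, LinearEquiv.symm_apply_eq, halign i ⟨hiS, hiT⟩]
  · simp [alignedSwap, hiS, hg]

theorem uniformFamily_real_inter_mul_eq [Finite α] [Finite V] [MeasurableSpace V]
    [MeasurableSingletonClass V] {S T : Set α} {E₁ E₂ : Set (α → V)} (hE₁ : DependsOn (· ∈ E₁) S)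
    (hE₂ : GLInvariantOn F T E₂) (hindep₁ : ∀ A ∈ E₁, LinearIndepOn F A (S ∩ T))
    (hindep₂ : ∀ A ∈ E₂, LinearIndepOn F A (S ∩ T)) :
    (uniformFamily α V).real (E₁ ∩ E₂) *
        (uniformFamily α V).real {A | LinearIndepOn F A (S ∩ T)} =
      (uniformFamily α V).real E₁ * (uniformFamily α V).real E₂ := by
  have hfst : ∀ p : (α → V) × (α → V), (alignedSwap F S (S ∩ T) p).1 ∈ E₁ ↔ p.1 ∈ E₁ :=
    fun p => iff_of_eq (hE₁ (alignedSwap_fst_eqOn S _ p))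
  have hsnd : ∀ p : (α → V) × (α → V),
      LinearIndepOn F (alignedSwap F S (S ∩ T) p).2 (S ∩ T) ↔ LinearIndepOn F p.2 (S ∩ T) :=
    fun p => iff_of_eq ((glInvariantOn_linearIndepOn _).dependsOn fun i hi =>
      alignedSwap_snd_eqOn S _ p hi.1)
  have hbij : Set.BijOn (alignedSwap F S (S ∩ T))
      ((E₁ ∩ E₂) ×ˢ {A | LinearIndepOn F A (S ∩ T)}) (E₁ ×ˢ E₂) := by
    have hinv := involutive_alignedSwap (F := F) (V := V) (Set.inter_subset_left (s := S) (t := T))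
    refine Set.InvOn.bijOn ⟨fun p _ => hinv p, fun p _ => hinv p⟩ ?_ ?_
    · rintro p ⟨⟨hp₁, hp₂⟩, hp⟩
      obtain ⟨g, -, hg⟩ := exists_eqOn_alignedSwap (hindep₁ p.1 hp₁) hp
      exact ⟨(hfst p).2 hp₁, (hE₂ _ _ _ hg).1 hp₂⟩
    · rintro p ⟨hp₁, hp₂⟩
      obtain ⟨g, hg, -⟩ := exists_eqOn_alignedSwap (hindep₁ p.1 hp₁) (hindep₂ p.2 hp₂)
      exact ⟨⟨(hfst p).2 hp₁, (hE₂ _ _ _ hg).1 hp₂⟩, (hsnd p).2 (hindep₂ p.2 hp₂)⟩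
  have hcard := hbij.ncard_eq
  rw [Set.ncard_prod, Set.ncard_prod] at hcard
  simp only [uniformFamily_real_apply, div_mul_div_comm]
  congr 1
  exact_mod_cast hcard

end GeneralLinear

theorem uniformFamily_real_isCircuitOn_congr {F α V : Type*} [Field F] [Finite α]
    [AddCommGroup V] [Module F V] [Finite V] [MeasurableSpace V] [MeasurableSingletonClass V]
    {S T : Finset α} (h : S.card = T.card) :
    (uniformFamily α V).real {A | IsCircuitOn F A S} =
      (uniformFamily α V).real {A | IsCircuitOn F A T} := by
  classical
  have := Fintype.ofFinite α
  let e : S ≃ T := Fintype.equivOfCardEq (by simpa using h)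
  have he : e.extendSubtype '' (S : Set α) = T := by
    refine Set.eq_of_subset_of_ncard_le ?_ ?_ (Set.toFinite _)
    · rintro _ ⟨i, hi, rfl⟩
      exact e.extendSubtype_mem i hi
    · simp [Set.ncard_image_of_injective _ e.extendSubtype.injective, h]
  rw [← uniformFamily_real_preimage_comp_perm e.extendSubtype {A : α → V | IsCircuitOn F A S}]
  simp only [Set.mem_ofPred_eq, isCircuitOn_comp_equiv, he]

section CircuitProbability

variable {F α V : Type*} [Field F] [Fintype F] [AddCommGroup V] [Module F V] [Fintype V]
  [MeasurableSpace V] [MeasurableSingletonClass V] {n : ℕ}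

theorem le_uniformFamily_real_isCircuitOn_insert [Finite α] [DecidableEq α] {U : Finset α} {l : α}
    (hl : l ∉ U) :
    ((Fintype.card F : ℝ) - 1) ^ U.card *
        ((uniformFamily α V).real {A | LinearIndepOn F A U} / Fintype.card V) ≤
      (uniformFamily α V).real {A | IsCircuitOn F A (insert l U : Finset α)} := by
  classical
  let E : (U → Fˣ) → Set (α → V) := fun c =>
    {A | LinearIndepOn F A U} ∩ {A | A l = ∑ i, (c i : F) • A i}
  have hUl : (U : Set α) ⊆ {l}ᶜ := Set.subset_compl_singleton_iff.2 hl
  have hE : ∀ c, (uniformFamily α V).real (E c) =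
      (uniformFamily α V).real {A | LinearIndepOn F A U} / Fintype.card V := fun c =>
    uniformFamily_real_inter_apply_eq ((glInvariantOn_linearIndepOn _).dependsOn.mono hUl)
      fun A B hAB => Finset.sum_congr rfl fun i _ => congrArg _ (hAB i (hUl i.2))
  have hdisj : Pairwise (Function.onFun Disjoint E) := fun c d hcd =>
    Set.disjoint_left.2 fun A hc hd => hcd <| by
      have hcoeff : (fun i => (c i : F)) = fun i => (d i : F) :=
        linearIndependent_iff_injective_fintypeLinearCombination.1 hc.1 (hc.2.symm.trans hd.2)
      exact funext fun i => Units.ext (congrFun hcoeff i)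
  calc ((Fintype.card F : ℝ) - 1) ^ U.card *
        ((uniformFamily α V).real {A | LinearIndepOn F A U} / Fintype.card V)
      = ∑ c, (uniformFamily α V).real (E c) := by
        simp [hE, Fintype.card_units, Nat.cast_pred Fintype.card_pos]
    _ = (uniformFamily α V).real (⋃ c, E c) :=
        (measureReal_iUnion_fintype hdisj fun _ => .of_discrete).symm
    _ ≤ (uniformFamily α V).real {A | IsCircuitOn F A (insert l U : Finset α)} :=
        measureReal_mono (Set.iUnion_subset fun c A hA =>
          isCircuitOn_insert hA.1 hl (fun i => (c i).ne_zero) hA.2) (measure_ne_top _ _)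

theorem inv_le_uniformFamily_real_isCircuitOn [Finite α] (hV : Fintype.card V = Fintype.card F ^ n)
    (hn : 0 < n) {S : Finset α} (hS : S.card = n) :
    (Fintype.card F * 2 ^ n : ℝ)⁻¹ ≤ (uniformFamily α V).real {A | IsCircuitOn F A S} := by
  classical
  obtain ⟨l, hl⟩ := Finset.card_pos.1 (hS ▸ hn)
  obtain ⟨U, hlU, rfl⟩ : ∃ U, l ∉ U ∧ insert l U = S :=
    ⟨S.erase l, Finset.notMem_erase l S, Finset.insert_erase hl⟩
  have hU : U.card + 1 = n := Finset.card_insert_of_notMem hlU ▸ hS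
  have hq : (2 : ℝ) ≤ Fintype.card F := by exact_mod_cast Fintype.one_lt_card (α := F)
  have hindep : (1 / 2 : ℝ) ≤ (uniformFamily α V).real {A | LinearIndepOn F A U} := by
    linarith [one_sub_half_pow_le_uniformFamily_real_linearIndepOn hV hU]
  calc (Fintype.card F * 2 ^ n : ℝ)⁻¹
      = (Fintype.card F / 2 : ℝ) ^ U.card * (1 / 2 / Fintype.card V) := by
        rw [hV, ← hU, div_pow, Nat.cast_pow]
        field_simp
        ring
    _ ≤ ((Fintype.card F : ℝ) - 1) ^ U.card *
          ((uniformFamily α V).real {A | LinearIndepOn F A U} / Fintype.card V) := by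
        gcongr ?_ ^ _ * (?_ / _)
        · exact pow_nonneg (by linarith) _
        · linarith
    _ ≤ _ := le_uniformFamily_real_isCircuitOn_insert hlU

theorem uniformFamily_real_isCircuitOn_inter_le [Finite α] [DecidableEq α]
    (hV : Fintype.card V = Fintype.card F ^ n) {S T : Finset α} (hS : S.card = n) (hT : T.card = n)
    (hST : S ≠ T) :
    (uniformFamily α V).real ({A | IsCircuitOn F A S} ∩ {A | IsCircuitOn F A T}) ≤
      (uniformFamily α V).real {A | IsCircuitOn F A S} *
        (uniformFamily α V).real {A | IsCircuitOn F A T} * (1 + 2 * (1 / 2) ^ (S \ T).card) := by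
  have hnST : ¬ S ⊆ T := fun h => hST (Finset.eq_of_subset_of_card_le h (by omega))
  have hnTS : ¬ T ⊆ S := fun h => hST (Finset.eq_of_subset_of_card_le h (by omega)).symm
  have hmul := uniformFamily_real_inter_mul_eq (F := F) (V := V) (S := (S : Set α)) (T := T)
    (glInvariantOn_isCircuitOn _).dependsOn (glInvariantOn_isCircuitOn _)
    (fun A hA => hA.2 _ (Set.inter_ssubset_left_iff.2 (mod_cast hnST)))
    (fun A hA => hA.2 _ (Set.inter_ssubset_right_iff.2 (mod_cast hnTS)))
  have hindep := one_sub_half_pow_le_uniformFamily_real_linearIndepOn (F := F) (V := V)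
    (U := S ∩ T) (j := (S \ T).card) hV (by rw [Finset.card_inter_add_card_sdiff, hS])
  rw [Finset.coe_inter] at hindep
  have hpow : (1 / 2 : ℝ) ^ (S \ T).card ≤ 1 / 2 :=
    pow_le_of_le_one (by norm_num) (by norm_num)
      (Finset.card_pos.2 (Finset.sdiff_nonempty.2 hnST)).ne'
  rw [← hmul, mul_assoc]
  refine le_mul_of_one_le_right measureReal_nonneg ?_
  have hpow0 : (0 : ℝ) ≤ (1 / 2) ^ (S \ T).card := by positivity
  nlinarith

end CircuitProbability

theorem sum_pow_card_sdiff {α R : Type*} [Fintype α] [DecidableEq α] [CommSemiring R] (x : R)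
    (S : Finset α) :
    ∑ T : Finset α, x ^ (S \ T).card = (1 + x) ^ S.card * 2 ^ (Fintype.card α - S.card) := by
  have hterm : ∀ T : Finset α, x ^ (S \ T).card =
      (∏ _i ∈ T, 1) * ∏ i ∈ Tᶜ, if i ∈ S then x else 1 := fun T => by
    rw [Finset.prod_const_one, one_mul, Finset.prod_ite_mem, Finset.prod_const, Finset.inter_comm,
      ← Finset.sdiff_eq_inter_compl]
  have hfactor : ∀ i, 1 + (if i ∈ S then x else 1) = if i ∈ S then 1 + x else 2 := fun i => by
    split_ifs
    exacts [rfl, one_add_one_eq_two]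
  rw [Finset.sum_congr rfl fun T _ => hterm T, ← Fintype.prod_add,
    Finset.prod_congr rfl fun i _ => hfactor i, Finset.prod_ite, Finset.prod_const,
    Finset.prod_const, Finset.filter_univ_mem, ← Finset.compl_filter, Finset.filter_univ_mem,
    Finset.card_compl]

theorem four_pow_le_four_mul_choose {n : ℕ} (hn : 0 < n) :
    4 ^ n ≤ 4 * n * (2 * n - 1).choose n := by
  have hcentral : n.centralBinom = 2 * (2 * n - 1).choose n := by
    obtain ⟨k, rfl⟩ := Nat.exists_eq_add_one.2 hn
    rw [Nat.centralBinom, show 2 * (k + 1) = 2 * k + 1 + 1 by ring, Nat.choose_succ_succ,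
      Nat.choose_symm_half, Nat.add_sub_cancel, Nat.choose_symm_half]
    ring
  linarith [hcentral ▸ Nat.four_pow_le_two_mul_self_mul_centralBinom n hn]

section HamiltonCircuits

variable {F : Type*} [Field F] [Fintype F] {n : ℕ}

theorem uniformFamily_real_forall_not_isCircuitOn_le {α V : Type*} [Fintype α] [AddCommGroup V]
    [Module F V] [Fintype V] [MeasurableSpace V] [MeasurableSingletonClass V]
    (hV : Fintype.card V = Fintype.card F ^ n) (hn : 0 < n) (hα : n ≤ Fintype.card α) :
    (uniformFamily α V).real {A | ∀ S : Finset α, S.card = n → ¬ IsCircuitOn F A S} ≤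
      (Fintype.card F * 2 ^ n + 2 * ((3 / 2) ^ n * 2 ^ (Fintype.card α - n))) /
        (Fintype.card α).choose n := by
  classical
  set s : Finset (Finset α) := Finset.powersetCard n Finset.univ
  have hs : ∀ {S}, S ∈ s ↔ S.card = n := Finset.mem_powersetCard_univ
  have hscard : s.card = (Fintype.card α).choose n := by
    rw [Finset.card_powersetCard, Finset.card_univ]
  have hs0 : s.Nonempty := Finset.card_pos.1 (hscard ▸ Nat.choose_pos hα)
  obtain ⟨S₀, hS₀⟩ := hs0
  set p := (uniformFamily α V).real {A | IsCircuitOn F A S₀}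
  have hEp : ∀ S ∈ s, (uniformFamily α V).real {A | IsCircuitOn F A S} = p := fun S hS =>
    uniformFamily_real_isCircuitOn_congr ((hs.1 hS).trans (hs.1 hS₀).symm)
  have hp : (Fintype.card F * 2 ^ n : ℝ)⁻¹ ≤ p :=
    inv_le_uniformFamily_real_isCircuitOn hV hn (hs.1 hS₀)
  have hp0 : 0 < p := lt_of_lt_of_le (by positivity) hp
  have hmoment := measureReal_forall_notMem_le_of_inter_le (μ := uniformFamily α V) (s := s)
    (E := fun S => {A | IsCircuitOn F A S}) (p := p)
    (b := fun S T => 2 * (1 / 2) ^ (S \ T).card) (fun _ _ => .of_discrete) ⟨S₀, hS₀⟩ hp0 hEp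
    (fun _ _ => by positivity)
    (fun S hS T hT hST => by
      have h := uniformFamily_real_isCircuitOn_inter_le hV (hs.1 hS) (hs.1 hT) hST
      rwa [hEp S hS, hEp T hT, ← sq] at h)
    (K := 2 * ((3 / 2) ^ n * 2 ^ (Fintype.card α - n)))
    (fun S hS => by
      rw [← Finset.mul_sum]
      gcongr
      refine (Finset.sum_le_univ_sum_of_nonneg fun T => by positivity).trans_eq ?_
      rw [sum_pow_card_sdiff, hs.1 hS]
      norm_num)
  simp only [hs, Set.mem_ofPred_eq, hscard] at hmoment
  refine hmoment.trans ?_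
  gcongr
  exact inv_le_of_inv_le₀ (by positivity) hp

theorem uniformFamily_real_forall_not_isCircuitOn_two_mul_sub_one_le {V : Type*} [AddCommGroup V]
    [Module F V] [Fintype V] [MeasurableSpace V] [MeasurableSingletonClass V]
    (hV : Fintype.card V = Fintype.card F ^ n) (hn : 0 < n) :
    (uniformFamily (Fin (2 * n - 1)) V).real
        {A | ∀ S : Finset (Fin (2 * n - 1)), S.card = n → ¬ IsCircuitOn F A S} ≤
      4 * (Fintype.card F + 2) * (n * (3 / 4) ^ n) := by
  have hmoment := uniformFamily_real_forall_not_isCircuitOn_le (F := F) (α := Fin (2 * n - 1))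
    (V := V) hV hn (by rw [Fintype.card_fin]; omega)
  rw [Fintype.card_fin] at hmoment
  have hchoose : (4 : ℝ) ^ n ≤ 4 * n * (2 * n - 1).choose n :=
    mod_cast four_pow_le_four_mul_choose hn
  have hchoose0 : (0 : ℝ) < (2 * n - 1).choose n := Nat.cast_pos.2 (Nat.choose_pos (by omega))
  refine hmoment.trans ((div_le_iff₀ hchoose0).2 ?_)
  have htwo : (2 : ℝ) ^ n ≤ 3 ^ n := by gcongr; norm_num
  have hthree : (3 / 2 : ℝ) ^ n * 2 ^ (2 * n - 1 - n) ≤ 3 ^ n :=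
    calc (3 / 2 : ℝ) ^ n * 2 ^ (2 * n - 1 - n) ≤ (3 / 2 : ℝ) ^ n * 2 ^ n := by
          gcongr
          · norm_num
          · omega
      _ = 3 ^ n := by rw [← mul_pow]; norm_num
  calc (Fintype.card F * 2 ^ n + 2 * ((3 / 2) ^ n * 2 ^ (2 * n - 1 - n)) : ℝ)
      ≤ Fintype.card F * 3 ^ n + 2 * 3 ^ n := by gcongr
    _ = (Fintype.card F + 2) * (3 / 4) ^ n * 4 ^ n := by
        rw [mul_assoc, ← mul_pow]
        norm_num
        ring
    _ ≤ (Fintype.card F + 2) * (3 / 4) ^ n * (4 * n * (2 * n - 1).choose n) := by gcongr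
    _ = 4 * (Fintype.card F + 2) * (n * (3 / 4) ^ n) * (2 * n - 1).choose n := by ring

end HamiltonCircuits

theorem columnMatroid_isCircuit_iff {F α ι : Type*} [Field F] [Finite α] {M : Matrix ι α F}
    {S : Set α} : M.columnMatroid.IsCircuit S ↔ IsCircuitOn F M.col S := by
  rw [Matroid.isCircuit_iff_forall_ssubset]
  exact and_congr_left' (and_iff_left (Set.subset_univ S))

section ColumnProcess

variable {F : Type*} [Field F] {n : ℕ} {w : ℕ → Fin n → F}

theorem circuitTime_le {N k : ℕ} {S : Finset (Fin N)} (hk : S.card = k)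
    (hS : IsCircuitOn F (fun i : Fin N => w i) S) : circuitTime w k ≤ N :=
  iInf₂_le N ⟨S, columnMatroid_isCircuit_iff.2 hS, (Set.ncard_coe_finset S).trans hk⟩

theorem isFirstCircuit_of_isCircuitOn {j : ℕ} {C : Set (Fin (j + 1))}
    (hw : LinearIndependent F (fun i : Fin j => w i))
    (hC : IsCircuitOn F (fun i : Fin (j + 1) => w i) C) : IsFirstCircuit w (j + 1) C := by
  have huniv : insert (Fin.last j) (Set.range Fin.castSucc) = Set.univ := by
    ext i
    induction i using Fin.lastCases <;> simp [-Fin.range_castSucc]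
  have hI : (firstColumns w (j + 1)).columnMatroid.Indep (Set.range Fin.castSucc) :=
    (linearIndepOn_range_iff (Fin.castSucc_injective j) _).2 hw
  have hunique : ∀ D, (firstColumns w (j + 1)).columnMatroid.IsCircuit D →
      D = (firstColumns w (j + 1)).columnMatroid.fundCircuit (Fin.last j)
        (Set.range Fin.castSucc) := fun D hD =>
    hD.eq_fundCircuit_of_subset hI (huniv ▸ Set.subset_univ D)
  have hC' : (firstColumns w (j + 1)).columnMatroid.IsCircuit C :=
    columnMatroid_isCircuit_iff.2 hC
  refine ⟨fun D => ⟨fun hD => (hunique D hD).trans (hunique C hC').symm, fun hD => hD ▸ hC'⟩,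
    fun m hm D hD => (columnMatroid_isCircuit_iff.1 hD).1 ?_⟩
  exact (hw.comp (Fin.castLE (Nat.lt_succ_iff.1 hm)) (Fin.castLE_injective _)).linearIndepOn D

end ColumnProcess

theorem isCircuitOn_insert_last {F V : Type*} [Field F] [DecidableEq F] [AddCommGroup V]
    [Module F V] {j : ℕ} {A : Fin (j + 1) → V} {x : Fin j → F}
    (hA : LinearIndependent F (fun i : Fin j => A i.castSucc))
    (hx : A (Fin.last j) = ∑ i, x i • A i.castSucc) :
    IsCircuitOn F A
      (insert (Fin.last j) (({i | x i ≠ 0} : Finset (Fin j)).map Fin.castSuccEmb) : Finset _) := by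
  have hindep : LinearIndepOn F A (Set.range Fin.castSucc) :=
    (linearIndepOn_range_iff (Fin.castSucc_injective j) A).2 hA
  have hsnoc : ∀ i, (Fin.snoc (α := fun _ => F) x 0 : Fin (j + 1) → F) i.castSucc = x i :=
    Fin.snoc_castSucc _ _
  refine isCircuitOn_insert (c := fun i => (Fin.snoc (α := fun _ => F) x 0 : Fin (j + 1) → F) i)
    (hindep.mono (by simp)) (by simp) ?_ ?_
  · simp [hsnoc]
  · rw [hx, Finset.sum_coe_sort _ fun i =>
      (Fin.snoc (α := fun _ => F) x 0 : Fin (j + 1) → F) i • A i, Finset.sum_map]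
    simp only [Fin.coe_castSuccEmb, hsnoc]
    exact (Finset.sum_filter_of_ne fun i _ h => left_ne_zero_of_smul h).symm

theorem exists_first_dependency {F V : Type*} [Field F] [AddCommGroup V] [Module F V]
    [FiniteDimensional F V] (w : ℕ → V) :
    ∃ j ≤ Module.finrank F V, LinearIndependent F (fun i : Fin j => w i) ∧
      ∃ x : Fin j → F, w j = ∑ i, x i • w i := by
  classical
  have hbound : ∀ {m}, LinearIndependent F (fun i : Fin m => w i) → m ≤ Module.finrank F V :=
    fun h => by simpa using h.fintype_card_le_finrank
  have hdep : ∃ m : ℕ, ¬ LinearIndependent F (fun i : Fin m => w i) :=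
    ⟨Module.finrank F V + 1, fun h => (hbound h).not_gt (Nat.lt_succ_self _)⟩
  obtain ⟨j, hj⟩ := Nat.exists_eq_succ_of_ne_zero
    (mt (Nat.find_eq_zero hdep).1 (not_not.2 linearIndependent_empty_type))
  have hindep : LinearIndependent F (fun i : Fin j => w i) :=
    not_not.1 (Nat.find_min hdep (hj ▸ Nat.lt_succ_self j))
  have hlast := hj ▸ Nat.find_spec hdep
  rw [linearIndependent_finSucc'] at hlast
  obtain ⟨x, hx⟩ := (Submodule.mem_span_range_iff_exists_fun F).1
    (not_not.1 fun h => hlast ⟨hindep, h⟩)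
  exact ⟨j, hbound hindep, hindep, x, hx.symm⟩

/-- Some member of the family `A` is a linear combination of its predecessors with exactly
`k - 1` nonzero coefficients. When `A` consists of the first `n + 1` vectors of a sequence in
`F ^ n`, the length of its first circuit is such a number `k`. -/
def HasDependencyOfLength (F : Type*) {V : Type*} [Field F] [DecidableEq F] [AddCommGroup V]
    [Module F V] {N : ℕ} (A : Fin N → V) (k : ℕ) : Prop :=
  ∃ (j : Fin N) (x : Fin j → F), 1 + hammingNorm x = k ∧
    A j = ∑ i, x i • A (Fin.castLE j.2.le i)

theorem exists_isFirstCircuit {F : Type*} [Field F] [DecidableEq F] {n : ℕ} (w : ℕ → Fin n → F) :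
    ∃ (m : ℕ) (C : Set (Fin m)), IsFirstCircuit w m C ∧
      HasDependencyOfLength F (fun i : Fin (n + 1) => w i) C.ncard := by
  obtain ⟨j, hj, hindep, x, hx⟩ := exists_first_dependency (F := F) w
  rw [Module.finrank_fin_fun] at hj
  refine ⟨j + 1, _, isFirstCircuit_of_isCircuitOn hindep
    (isCircuitOn_insert_last (x := x) hindep hx), ⟨j, Nat.lt_succ_iff.2 hj⟩, x, ?_, hx⟩
  rw [Set.ncard_coe_finset, Finset.card_insert_of_notMem (by simp), Finset.card_map, add_comm]
  rfl

theorem uniformFamily_real_apply_eq_sum_castLE {F V : Type*} [Field F] [AddCommGroup V]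
    [Module F V] [Fintype V] [MeasurableSpace V] [MeasurableSingletonClass V] {N : ℕ} (j : Fin N)
    (x : Fin j → F) :
    (uniformFamily (Fin N) V).real {A | A j = ∑ i, x i • A (Fin.castLE j.2.le i)} =
      1 / Fintype.card V := by
  rw [← Set.univ_inter {A : Fin N → V | A j = _}, uniformFamily_real_inter_apply_eq
    (fun _ _ _ => rfl) fun A B hAB => Finset.sum_congr rfl fun i _ =>
      congrArg _ (hAB _ (Set.mem_compl_singleton_iff.2 (Fin.ne_of_lt i.2))), probReal_univ]

theorem hammingNorm_cons {M : Type*} [Zero M] [DecidableEq M] {j : ℕ} (c : M) (x : Fin j → M) :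
    hammingNorm (Fin.cons c x : Fin (j + 1) → M) = (if c = 0 then 0 else 1) + hammingNorm x := by
  simp only [hammingNorm, Finset.card_filter, Fin.sum_univ_succ, Fin.cons_zero, Fin.cons_succ,
    ne_eq, ite_not]

theorem card_filter_lt_abs_le_sum_sq_div_sq {ι : Type*} [Fintype ι] (f : ι → ℝ) {d : ℝ}
    (hd : 0 < d) :
    (Finset.card {x | d < |f x|} : ℝ) ≤ (∑ x, f x ^ 2) / d ^ 2 := by
  rw [le_div_iff₀ (by positivity), ← nsmul_eq_mul]
  refine (Finset.card_nsmul_le_sum _ (fun x => f x ^ 2) _ fun x hx => ?_).trans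
    (Finset.sum_le_univ_sum_of_nonneg fun x => sq_nonneg _)
  rw [← sq_abs (f x)]
  exact pow_le_pow_left₀ hd.le (Finset.mem_filter.1 hx).2.le 2

theorem sum_half_pow_mul_add_sq (c : ℝ) (N : ℕ) :
    ∑ i ∈ Finset.range N, (1 / 2 : ℝ) ^ i * (c + (1 + i) ^ 2) =
      2 * c + 12 - (2 * c + 2 * N ^ 2 + 8 * N + 12) * (1 / 2 : ℝ) ^ N := by
  induction N with
  | zero => simp
  | succ N ih =>
    rw [Finset.sum_range_succ, ih, pow_succ]
    push_cast
    ring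

section HammingWeight

variable {F : Type*} [Field F] [Fintype F] [DecidableEq F] {n j : ℕ}

theorem sum_hammingNorm_sub_sq (j : ℕ) (a : ℝ) :
    ∑ x : Fin j → F, (hammingNorm x - a) ^ 2 =
      (Fintype.card F : ℝ) ^ j * (j * ((1 - (Fintype.card F : ℝ)⁻¹) * (Fintype.card F : ℝ)⁻¹) +
        (j * (1 - (Fintype.card F : ℝ)⁻¹) - a) ^ 2) := by
  induction j generalizing a with
  | zero => simp [hammingNorm]
  | succ j ih =>
    have hzero : ∀ x : Fin j → F,
        ((hammingNorm (Fin.cons 0 x : Fin (j + 1) → F) : ℝ) - a) ^ 2 = (hammingNorm x - a) ^ 2 :=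
      fun x => by simp [hammingNorm_cons]
    have hne : ∀ c ∈ Finset.univ.erase (0 : F), ∑ x : Fin j → F,
        ((hammingNorm (Fin.cons c x : Fin (j + 1) → F) : ℝ) - a) ^ 2 =
          ∑ x : Fin j → F, (hammingNorm x - (a - 1)) ^ 2 := fun c hc =>
      Finset.sum_congr rfl fun x _ => by
        rw [hammingNorm_cons, if_neg (Finset.ne_of_mem_erase hc)]
        push_cast
        ring
    rw [← (Fin.consEquiv fun _ : Fin (j + 1) => F).sum_comp, Fintype.sum_prod_type,
      ← Finset.add_sum_erase _ _ (Finset.mem_univ (0 : F))]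
    simp only [Fin.consEquiv, Equiv.coe_fn_mk]
    rw [Finset.sum_congr rfl fun x _ => hzero x, Finset.sum_congr rfl hne, Finset.sum_const,
      Finset.card_erase_of_mem (Finset.mem_univ _), nsmul_eq_mul, Finset.card_univ,
      Nat.cast_pred Fintype.card_pos, ih, ih]
    push_cast
    field_simp
    ring

theorem sum_hammingNorm_deviation_sq_le (hj : j ≤ n) :
    ∑ x : Fin j → F, (((1 + hammingNorm x : ℕ) : ℝ) - (1 - (Fintype.card F : ℝ)⁻¹) * n) ^ 2 ≤
      (Fintype.card F : ℝ) ^ j * (n + (1 + (n - j : ℕ)) ^ 2) := by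
  obtain ⟨i, rfl⟩ := Nat.exists_eq_add_of_le hj
  rw [Nat.add_sub_cancel_left]
  have hq : (1 : ℝ) ≤ Fintype.card F := Nat.one_le_cast.2 Fintype.card_pos
  set p : ℝ := (Fintype.card F : ℝ)⁻¹
  have hp0 : 0 ≤ p := by positivity
  have hp1 : p ≤ 1 := inv_le_one_of_one_le₀ hq
  have hvariance : (j : ℝ) * ((1 - p) * p) ≤ j :=
    mul_le_of_le_one_right (Nat.cast_nonneg j) (mul_le_one₀ (by linarith) hp0 hp1)
  have hbias : (1 - (1 - p) * i) ^ 2 ≤ (1 + i : ℝ) ^ 2 := by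
    have hi : (0 : ℝ) ≤ i := Nat.cast_nonneg i
    have hle : (1 - p) * i ≤ i := mul_le_of_le_one_left hi (by linarith)
    have hge : 0 ≤ (1 - p) * i := mul_nonneg (by linarith) hi
    exact sq_le_sq' (by linarith) (by linarith)
  calc ∑ x : Fin j → F, (((1 + hammingNorm x : ℕ) : ℝ) - (1 - p) * (j + i : ℕ)) ^ 2
      = ∑ x : Fin j → F, (hammingNorm x - ((1 - p) * (j + i : ℕ) - 1)) ^ 2 :=
        Finset.sum_congr rfl fun x _ => by push_cast; ring
    _ = (Fintype.card F : ℝ) ^ j * (j * ((1 - p) * p) + (1 - (1 - p) * i) ^ 2) := by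
        rw [sum_hammingNorm_sub_sq]
        push_cast
        ring
    _ ≤ (Fintype.card F : ℝ) ^ j * ((j + i : ℕ) + (1 + i) ^ 2) := by
        gcongr
        push_cast
        linarith

theorem uniformFamily_real_exists_dependency_le {V : Type*} [AddCommGroup V] [Module F V]
    [Fintype V] [MeasurableSpace V] [MeasurableSingletonClass V]
    (hV : Fintype.card V = Fintype.card F ^ n) {N : ℕ} (j : Fin N) (hj : j ≤ n) {d : ℝ}
    (hd : 0 < d) :
    (uniformFamily (Fin N) V).real {A | ∃ x : Fin j → F,
        d < |((1 + hammingNorm x : ℕ) : ℝ) - (1 - (Fintype.card F : ℝ)⁻¹) * n| ∧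
          A j = ∑ i, x i • A (Fin.castLE j.2.le i)} ≤
      (1 / 2) ^ (n - j : ℕ) * (n + (1 + (n - j : ℕ)) ^ 2) / d ^ 2 := by
  have hq : (2 : ℝ) ≤ Fintype.card F := by exact_mod_cast Fintype.one_lt_card (α := F)
  set q : ℝ := (Fintype.card F : ℝ)
  let D : Finset (Fin j → F) := {x | d < |((1 + hammingNorm x : ℕ) : ℝ) - (1 - q⁻¹) * n|}
  let E : (Fin j → F) → Set (Fin N → V) := fun x =>
    {A | A j = ∑ i, x i • A (Fin.castLE j.2.le i)}
  calc _ ≤ (uniformFamily (Fin N) V).real (⋃ x ∈ D, E x) := by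
        refine measureReal_mono ?_ (measure_ne_top _ _)
        rintro A ⟨x, hx, hAx⟩
        exact Set.mem_biUnion (Finset.mem_filter.2 ⟨Finset.mem_univ x, hx⟩) hAx
    _ ≤ ∑ x ∈ D, (uniformFamily (Fin N) V).real (E x) := measureReal_biUnion_finset_le _ _
    _ = D.card * (1 / Fintype.card V) := by
        rw [← nsmul_eq_mul]
        exact Finset.sum_eq_card_nsmul fun x _ => uniformFamily_real_apply_eq_sum_castLE j x
    _ ≤ q ^ (j : ℕ) * (n + (1 + (n - j : ℕ)) ^ 2) / d ^ 2 * (1 / Fintype.card V) := by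
        gcongr
        refine (card_filter_lt_abs_le_sum_sq_div_sq _ hd).trans ?_
        gcongr
        exact sum_hammingNorm_deviation_sq_le hj
    _ = q⁻¹ ^ (n - j : ℕ) * (n + (1 + (n - j : ℕ)) ^ 2) / d ^ 2 := by
        have hpow : q ^ n = q ^ (j : ℕ) * q ^ (n - j : ℕ) := by
          rw [← pow_add, Nat.add_sub_of_le hj]
        rw [hV, Nat.cast_pow, hpow, inv_pow]
        field_simp
    _ ≤ (1 / 2) ^ (n - j : ℕ) * (n + (1 + (n - j : ℕ)) ^ 2) / d ^ 2 := by
        rw [one_div]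
        gcongr

theorem uniformFamily_real_exists_hasDependencyOfLength_le {V : Type*} [AddCommGroup V]
    [Module F V] [Fintype V] [MeasurableSpace V] [MeasurableSingletonClass V]
    (hV : Fintype.card V = Fintype.card F ^ n) {d : ℝ} (hd : 0 < d) :
    (uniformFamily (Fin (n + 1)) V).real {A | ∃ k : ℕ,
        d < |k - (1 - (Fintype.card F : ℝ)⁻¹) * n| ∧ HasDependencyOfLength F A k} ≤
      (2 * n + 12) / d ^ 2 := by
  calc _ ≤ (uniformFamily (Fin (n + 1)) V).real (⋃ j : Fin (n + 1), {A | ∃ x : Fin j → F,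
          d < |((1 + hammingNorm x : ℕ) : ℝ) - (1 - (Fintype.card F : ℝ)⁻¹) * n| ∧
            A j = ∑ i, x i • A (Fin.castLE j.2.le i)}) := by
        refine measureReal_mono ?_ (measure_ne_top _ _)
        rintro A ⟨_, hk, j, x, rfl, hx⟩
        exact Set.mem_iUnion.2 ⟨j, x, hk, hx⟩
    _ ≤ ∑ j : Fin (n + 1), (1 / 2) ^ (n - j : ℕ) * (n + (1 + (n - j : ℕ)) ^ 2) / d ^ 2 :=
        (measureReal_iUnion_fintype_le _).trans <| Finset.sum_le_sum fun j _ =>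
          uniformFamily_real_exists_dependency_le hV j (Nat.lt_succ_iff.1 j.2) hd
    _ = (∑ i ∈ Finset.range (n + 1), (1 / 2 : ℝ) ^ i * (n + (1 + i) ^ 2)) / d ^ 2 := by
        rw [← Finset.sum_div, Fin.sum_univ_eq_sum_range
          (fun j => (1 / 2 : ℝ) ^ (n - j) * (n + (1 + (n - j : ℕ)) ^ 2)),
          Finset.sum_flip fun i => (1 / 2 : ℝ) ^ i * (n + (1 + i) ^ 2)]
    _ ≤ (2 * n + 12) / d ^ 2 := by
        gcongr
        rw [sum_half_pow_mul_add_sq]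
        exact sub_le_self _ (by positivity)

end HammingWeight

theorem tendsto_mul_add_div_mul_sq (a b : ℝ) {c : ℝ} (hc : c ≠ 0) :
    Tendsto (fun n : ℕ => (a * n + b) / (c * n) ^ 2) atTop (𝓝 0) := by
  have hinv := tendsto_inv_atTop_nhds_zero_nat (𝕜 := ℝ)
  have hsum : Tendsto (fun n : ℕ => a / c ^ 2 * (n : ℝ)⁻¹ + b / c ^ 2 * ((n : ℝ)⁻¹ * (n : ℝ)⁻¹))
      atTop (𝓝 0) := by
    simpa using (hinv.const_mul (a / c ^ 2)).add ((hinv.mul hinv).const_mul (b / c ^ 2))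
  refine hsum.congr' ?_
  filter_upwards [eventually_ne_atTop 0] with n hn
  field_simp

theorem mainTheorem7 {F : Type*} [Field F] [Fintype F]
    [MeasurableSpace F] [MeasurableSingletonClass F]
    {Ω : ℕ → Type*} [∀ n, MeasurableSpace (Ω n)]
    (P : ∀ n, Measure (Ω n)) [∀ n, IsProbabilityMeasure (P n)]
    (v : ∀ n, ℕ → Ω n → (Fin n → F))
    (hlaw : ∀ n i, HasLaw (v n i) (uniformOn Set.univ) (P n))
    (hindep : ∀ n, iIndepFun (v n) (P n)) :
    (∀ ε : ℝ, 0 < ε →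
      Tendsto (fun n : ℕ => P n {ω | ∃ (m : ℕ) (C : Set (Fin m)),
          IsFirstCircuit (fun i => v n i ω) m C ∧
          |(C.ncard : ℝ) - (1 - (Fintype.card F : ℝ)⁻¹) * n|
            ≤ ε * ((1 - (Fintype.card F : ℝ)⁻¹) * n)})
        atTop (𝓝 1)) ∧
    Tendsto (fun n : ℕ => P n {ω | circuitTime (fun i => v n i ω) n < ((2 * n : ℕ) : ℕ∞)})
      atTop (𝓝 1) := by
  classical
  have hfamily : ∀ N : ℕ → ℕ, ∀ n, HasLaw (fun ω (i : Fin (N n)) => v n i ω)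
      (uniformFamily (Fin (N n)) (Fin n → F)) (P n) := fun N n =>
    hasLaw_uniformFamily (fun i => hlaw n i) ((hindep n).precomp Fin.val_injective)
  have hcard : ∀ n, Fintype.card (Fin n → F) = Fintype.card F ^ n := by simp
  refine ⟨fun ε hε => ?_, ?_⟩
  · have hp : 0 < 1 - (Fintype.card F : ℝ)⁻¹ :=
      sub_pos.2 (inv_lt_one_of_one_lt₀ (mod_cast Fintype.one_lt_card (α := F)))
    refine tendsto_measure_one_of_hasLaw (hfamily (· + 1)) (fun _ => .of_discrete)
      ((eventually_gt_atTop 0).mono fun n hn => uniformFamily_real_exists_hasDependencyOfLength_le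
        (hcard n) (mul_pos hε (mul_pos hp (Nat.cast_pos.2 hn))))
      (by simpa only [mul_assoc] using tendsto_mul_add_div_mul_sq _ _ (mul_pos hε hp).ne')
      (.of_forall fun n ω hω => ?_)
    obtain ⟨m, C, hC, hlength⟩ := exists_isFirstCircuit fun i => v n i ω
    exact ⟨m, C, hC, not_lt.1 fun hlt => hω ⟨_, hlt, hlength⟩⟩
  · refine tendsto_measure_one_of_hasLaw (hfamily (2 * · - 1)) (fun _ => .of_discrete)
      ((eventually_gt_atTop 0).mono fun n hn =>
        uniformFamily_real_forall_not_isCircuitOn_two_mul_sub_one_le (hcard n) hn) ?_ ?_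
    · simpa using (tendsto_self_mul_const_pow_of_lt_one (r := (3 / 4 : ℝ)) (by norm_num)
        (by norm_num)).const_mul (4 * (Fintype.card F + 2) : ℝ)
    · filter_upwards [eventually_gt_atTop 0] with n hn ω hω
      simp only [not_forall, not_not] at hω
      obtain ⟨S, hSn, hS⟩ := hω
      have hlt : ((2 * n - 1 : ℕ) : ℕ∞) < (2 * n : ℕ) := Nat.cast_lt.2 (by omega)
      exact (circuitTime_le (w := fun i => v n i ω) hSn hS).trans_lt hlt
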